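/- Let $k\ge 2$ and $N\ge 1$. The $(k,N)$-cluster network has nodes $v_{i,j}$ ($1\le i\le k$, $1\le j\le N$), vertical edges $(v_{i,j},v_{i+1,j})$ ($1\le i\le k-1$, $1\le j\le N$) and horizontal edges $(v_{i,j},v_{i,j+1})$ ($1\le i\le k$, $1\le j\le N-1$). Its resource state $|\Phi\rangle$ is the tensor product, over all edges, of EPR states $\frac1{\sqrt2}(|00\rangle+|11\rangle)$ of two qubits, one at each endpoint of the edge. In addition there is an input qubit at each node $v_{i,1}$ and an output qubit at each node $v_{i,N}$. A unitary operation $U$ from the $k$ input qubits to the $k$ output qubits is called deterministically implementable over the network if there is a map $\Gamma$, realized by a finite-round protocol of local operations at the nodes (arbitrary quantum instruments, including ancillas and discarding of subsystems) and classical communication between the nodes (LOCC), such that $\Gamma(|\psi\rangle\langle\psi|\otimes|\Phi\rangle\langle\Phi|)=U|\psi\rangle\langle\psi|U^\dagger$ for every pure state $|\psi\rangle$ of the input qubits. If $U$ is deterministically implementable over the $(k,N)$-cluster network, then the matrix $U^M$ of $U$ in the computational basis can be decomposed as $$U^M=V_1V_2\cdots V_N,$$ where each $V_i$ is a $2^k\times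 2^k$ unitary matrix of the form $$V_i=\sum_{a_1=0}^1\cdots\sum_{a_{k-1}=0}^1 E^{(a_1)}_{1,i}\otimes E^{(a_1,a_2)}_{2,i}\otimes E^{(a_2,a_3)}_{3,i}\otimes\cdots\otimes E^{(a_{k-2},a_{k-1})}_{k-1,i}\otimes E^{(a_{k-1})}_{k,i}$$ with $2\times 2$ complex matrices $E^{(a)}_{1,i}$, $E^{(a,b)}_{j,i}$ ($2\le j\le k-1$) and $E^{(a)}_{k,i}$. -/

import Mathlib

open scoped Matrix

/-- A quantum instrument from the finite-dimensional space with orthonormal basis `H` to the one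
with orthonormal basis `L`, in Kraus form: outcome `o` is the completely positive map
`ρ ↦ ∑ j, E o j * ρ * (E o j)ᴴ`, and the sum of these maps over all outcomes is trace preserving.
There are finitely many outcomes. A single outcome gives a deterministic operation (a CPTP map);
attaching ancillas and discarding subsystems are instruments, since `L` is arbitrary. -/
structure Instrument (H L : Type) [Fintype H] [DecidableEq H] [Fintype L] where
  /-- number of classical outcomes -/
  outcomes : ℕ
  /-- number of Kraus operators per outcome -/
  rank : ℕ
  /-- the Kraus operators -/
  kraus : Fin outcomes → Fin rank → Matrix L H ℂ
  /-- the sum over all outcomes is trace preserving -/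
  complete : ∑ o, ∑ j, (kraus o j)ᴴ * kraus o j = 1

/-- The tensor product `⨂ p, A p` of local operators, as a matrix in the product bases. -/
def localTensor {P : Type} [Fintype P] {H L : P → Type} (A : ∀ p, Matrix (L p) (H p) ℂ) :
    Matrix (∀ p, L p) (∀ p, H p) ℂ :=
  Matrix.of fun x y => ∏ p, A p (x p) (y p)

/-- The completely positive map on the joint system when every party `p` applies its instrument
`M p` and obtains the outcome `o p`, i.e. the tensor product of the maps of these outcomes. -/
noncomputable def jointOutcomeMap {P : Type} [Fintype P] [DecidableEq P] {H L : P → Type}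
    [∀ p, Fintype (H p)] [∀ p, DecidableEq (H p)] [∀ p, Fintype (L p)]
    (M : ∀ p, Instrument (H p) (L p)) (o : ∀ p, Fin (M p).outcomes)
    (ρ : Matrix (∀ p, H p) (∀ p, H p) ℂ) : Matrix (∀ p, L p) (∀ p, L p) ℂ :=
  ∑ j : (∀ p, Fin (M p).rank),
    localTensor (fun p => (M p).kraus (o p) (j p)) * ρ *
      (localTensor (fun p => (M p).kraus (o p) (j p)))ᴴ

/-- `IsLOCC K H Γ`: the map `Γ` from operators on `⨂ p, ℂ^(H p)` to operators on `⨂ p, ℂ^(K p)`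
is implemented by a (finite-round) protocol of local operations and classical communication among
the parties `p : P`. In a round every party applies a local instrument (which may be the identity,
so rounds in which only one party acts are included); all outcomes are announced to everybody and
the remaining protocol may depend on all of them. At the end all outcomes are discarded, i.e. summed
over. -/
inductive IsLOCC {P : Type} [Fintype P] [DecidableEq P]
    (K : P → Type) [∀ p, Fintype (K p)] [∀ p, DecidableEq (K p)] :
    ∀ (H : P → Type) [∀ p, Fintype (H p)] [∀ p, DecidableEq (H p)],
      (Matrix (∀ p, H p) (∀ p, H p) ℂ → Matrix (∀ p, K p) (∀ p, K p) ℂ) → Prop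
  | done : IsLOCC K K (fun ρ => ρ)
  | round {H L : P → Type} [∀ p, Fintype (H p)] [∀ p, DecidableEq (H p)]
      [∀ p, Fintype (L p)] [∀ p, DecidableEq (L p)]
      (M : ∀ p, Instrument (H p) (L p))
      (Γ : (∀ p, Fin (M p).outcomes) →
        Matrix (∀ p, L p) (∀ p, L p) ℂ → Matrix (∀ p, K p) (∀ p, K p) ℂ)
      (hΓ : ∀ o, IsLOCC K L (Γ o)) :
      IsLOCC K H (fun ρ => ∑ o, Γ o (jointOutcomeMap M o ρ))

/-- The nodes `v_{i,j}` of the `(k,N)`-cluster network (indices start at `0`). -/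
abbrev ClusterNode (k N : ℕ) : Type := Fin k × Fin N

/-- The edges of the `(k,N)`-cluster network: `Sum.inl (i, j)` is the vertical edge from `v_{i,j}`
to `v_{i+1,j}`, and `Sum.inr (i, j)` is the horizontal edge from `v_{i,j}` to `v_{i,j+1}`. -/
abbrev ClusterEdge (k N : ℕ) : Type := (Fin (k - 1) × Fin N) ⊕ (Fin k × Fin (N - 1))

/-- The two endpoints (numbered `0` and `1`) of an edge. -/
def ClusterEdge.endpoint {k N : ℕ} : ClusterEdge k N → Fin 2 → ClusterNode k N
  | Sum.inl (i, j), s => (⟨i.val + s.val, by omega⟩, j)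
  | Sum.inr (i, j), s => (i, ⟨j.val + s.val, by omega⟩)

/-- The qubits present at the start: the input qubits `i : Fin k`, and for each edge the two
qubits of its EPR pair, one for each endpoint. -/
abbrev InitialQubit (k N : ℕ) : Type := Fin k ⊕ (ClusterEdge k N × Fin 2)

/-- The node that holds a given initial qubit: the `i`-th input qubit is at the node `v_{i,1}` in
the first column, and each EPR qubit is at the corresponding endpoint of its edge. -/
def initialNode {k N : ℕ} (hN : 1 ≤ N) : InitialQubit k N → ClusterNode k N
  | Sum.inl i => (i, ⟨0, hN⟩)
  | Sum.inr (e, s) => e.endpoint s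

/-- The node that holds the `i`-th output qubit: `v_{i,N}`, in the last column. -/
def outputNode {k N : ℕ} (hN : 1 ≤ N) (i : Fin k) : ClusterNode k N :=
  (i, ⟨N - 1, by omega⟩)

/-- For qubits `Q` placed at nodes by `loc`, the computational basis of the space of the qubits
at the node `v` (a one-point basis if there are none). -/
abbrev LocalBasis {Q V : Type} (loc : Q → V) (v : V) : Type := {q : Q // loc q = v} → Fin 2

/-- The bit string of all the qubits that corresponds to a product of local basis vectors. -/
def joinBits {Q V : Type} (loc : Q → V) (x : ∀ v, LocalBasis loc v) : Q → Fin 2 :=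
  fun q => x (loc q) ⟨q, rfl⟩

/-- The rank-one operator `|φ⟩⟨φ|`. -/
def ketbra {ι : Type} (φ : ι → ℂ) : Matrix ι ι ℂ := Matrix.vecMulVec φ (star φ)

/-- The resource state: the product over all edges of the EPR states
`(|00⟩ + |11⟩) / √2` of the two qubits of the edge. -/
noncomputable def resourceState (k N : ℕ) (b : ClusterEdge k N × Fin 2 → Fin 2) : ℂ :=
  ∏ e : ClusterEdge k N, if b (e, 0) = b (e, 1) then ((1 / Real.sqrt 2 : ℝ) : ℂ) else 0

/-- The initial ket `|ψ⟩ ⊗ |Φ⟩`, where `ψ` is the state of the input qubits and `Φ` is the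
resource state, distributed over the nodes of the network. -/
noncomputable def initialKet {k N : ℕ} (hN : 1 ≤ N) (ψ : (Fin k → Fin 2) → ℂ)
    (x : ∀ v, LocalBasis (initialNode (k := k) hN) v) : ℂ :=
  ψ (fun i => joinBits (initialNode hN) x (Sum.inl i)) *
    resourceState k N (fun r => joinBits (initialNode hN) x (Sum.inr r))

/-- The ket of the output qubits with amplitudes `φ`, distributed over the nodes. -/
def outputKet {k N : ℕ} (hN : 1 ≤ N) (φ : (Fin k → Fin 2) → ℂ)
    (x : ∀ v, LocalBasis (outputNode (k := k) hN) v) : ℂ :=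
  φ (joinBits (outputNode hN) x)

/-- The `k`-qubit operation with matrix `U` in the computational basis is deterministically
implementable over the `(k,N)`-cluster network: one LOCC map among the nodes takes
`|ψ⟩⟨ψ| ⊗ |Φ⟩⟨Φ|` to `U |ψ⟩⟨ψ| U†` for every pure state `ψ` of the input qubits. -/
def DeterministicallyImplementable {k N : ℕ} (hN : 1 ≤ N)
    (U : Matrix (Fin k → Fin 2) (Fin k → Fin 2) ℂ) : Prop :=
  ∃ Γ : Matrix (∀ v, LocalBasis (initialNode (k := k) hN) v)
        (∀ v, LocalBasis (initialNode (k := k) hN) v) ℂ →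
      Matrix (∀ v, LocalBasis (outputNode (k := k) hN) v)
        (∀ v, LocalBasis (outputNode (k := k) hN) v) ℂ,
    IsLOCC (LocalBasis (outputNode (k := k) hN)) (LocalBasis (initialNode (k := k) hN)) Γ ∧
    ∀ ψ : (Fin k → Fin 2) → ℂ, star ψ ⬝ᵥ ψ = 1 →
      Γ (ketbra (initialKet hN ψ)) = ketbra (outputKet hN (U *ᵥ ψ))

/-- The factor of qubit `q` (counted from `0`) in the term of a chain sum with indices
`a_1, …, a_{k-1}`, where `a_{n+1}` is `a n`: `E^{(a_1)}` for the first qubit, `E^{(a_{k-1})}` for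
the last one, and `E^{(a_q, a_{q+1})}` for the others. (The last branch occurs only for `k = 1`,
where there is nothing to sum over.) -/
def chainFactor {k : ℕ} (first last : Fin 2 → Matrix (Fin 2) (Fin 2) ℂ)
    (mid : Fin k → Fin 2 → Fin 2 → Matrix (Fin 2) (Fin 2) ℂ)
    (a : Fin (k - 1) → Fin 2) (q : Fin k) : Matrix (Fin 2) (Fin 2) ℂ :=
  if hl : 0 < q.val then
    if hr : q.val + 1 < k then mid q (a ⟨q.val - 1, by omega⟩) (a ⟨q.val, by omega⟩)
    else last (a ⟨q.val - 1, by omega⟩)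
  else
    if hr : q.val + 1 < k then first (a ⟨q.val, by omega⟩)
    else mid q 0 0

/-- `V` has chain form: `V = ∑_{a_1, …, a_{k-1}} E_1^{(a_1)} ⊗ E_2^{(a_1,a_2)} ⊗ ⋯ ⊗
E_{k-1}^{(a_{k-2},a_{k-1})} ⊗ E_k^{(a_{k-1})}` for some complex `2 × 2` matrices. -/
def HasChainForm {k : ℕ} (V : Matrix (Fin k → Fin 2) (Fin k → Fin 2) ℂ) : Prop :=
  ∃ (first last : Fin 2 → Matrix (Fin 2) (Fin 2) ℂ)
    (mid : Fin k → Fin 2 → Fin 2 → Matrix (Fin 2) (Fin 2) ℂ),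
    V = ∑ a : Fin (k - 1) → Fin 2, localTensor (chainFactor first last mid a)

/-! An LOCC map is separable, so it has Kraus operators `localTensor (A m)`
(`IsLOCC.exists_product_kraus`). Contracting such an operator with the EPR pairs gives `α` times a
product of column operators `W m j`, where `α = eprScale` (`localTensor_mulVec_initialKet`). Each
column operator is a contraction over the vertical edges of one column, which is exactly chain form.
Since every pure input is sent to the pure state `U ψ`, each of these operators is `c m • U` with `∑
m, ‖c m‖ ^ 2 = 1` (`exists_smul_of_sum_ketbra`).

It remains to see that the factors are multiples of unitaries. Write `d = 2 ^ k`. AM-GM for the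
squared singular values gives `d * |det W| ^ (2 / d) ≤ ‖W‖²` in the Frobenius norm. Determinants are
multiplicative, so taking the product over columns and the sum over `m` bounds `∑ m, ∏ j, ‖W m j‖²`
below by `d ^ N / |α| ^ 2`. On the other hand, completeness of the Kraus operators, tested on
vectors whose horizontal bits are independent at the two ends of an edge, evaluates this sum as
exactly `d ^ N / |α| ^ 2` (`sum_prod_frobeniusSq_columnOperator`, `norm_eprScale_sq`). Equality
therefore holds throughout, and whenever `c m ≠ 0` all singular values of each `W m j` coincide.
Rescaling the columns of one such `m` gives the factorization. -/

theorem prod_sum_eq_sum_prod_pi {P : Type} [Fintype P] [DecidableEq P] {κ : P → Type}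
    [∀ p, Fintype (κ p)] (f : ∀ p, κ p → ℂ) :
    ∏ p, ∑ j, f p j = ∑ x : ∀ p, κ p, ∏ p, f p (x p) := by
  rw [Finset.prod_univ_sum, Fintype.piFinset_univ]

/-! ### Product operators and separability of LOCC maps -/

section LocalTensor

variable {P : Type} [Fintype P] {H L K : P → Type}

theorem localTensor_mul [DecidableEq P] [∀ p, Fintype (L p)] (A : ∀ p, Matrix (K p) (L p) ℂ)
    (B : ∀ p, Matrix (L p) (H p) ℂ) :
    localTensor A * localTensor B = localTensor (fun p => A p * B p) := by
  ext x y
  simp only [localTensor, Matrix.mul_apply, Matrix.of_apply, prod_sum_eq_sum_prod_pi,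
    Finset.prod_mul_distrib]

theorem localTensor_conjTranspose (A : ∀ p, Matrix (L p) (H p) ℂ) :
    (localTensor A)ᴴ = localTensor (fun p => (A p)ᴴ) := by
  ext x y
  simp [localTensor, Matrix.conjTranspose_apply]

theorem localTensor_one [∀ p, DecidableEq (H p)] :
    localTensor (fun p => (1 : Matrix (H p) (H p) ℂ)) = 1 := by
  ext x y
  simp only [localTensor, Matrix.of_apply, Matrix.one_apply]
  rw [Finset.prod_ite_zero]
  simp [funext_iff]

theorem sum_localTensor [DecidableEq P] {κ : P → Type} [∀ p, Fintype (κ p)]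
    (A : ∀ p, κ p → Matrix (L p) (H p) ℂ) :
    ∑ x : ∀ p, κ p, localTensor (fun p => A p (x p)) = localTensor (fun p => ∑ j, A p j) := by
  ext x y
  simp only [localTensor, Matrix.of_apply, Matrix.sum_apply, prod_sum_eq_sum_prod_pi]

theorem sum_jointKraus_complete [DecidableEq P] [∀ p, Fintype (H p)] [∀ p, DecidableEq (H p)]
    [∀ p, Fintype (L p)] (M : ∀ p, Instrument (H p) (L p)) :
    ∑ o : ∀ p, Fin (M p).outcomes, ∑ j : ∀ p, Fin (M p).rank,
      (localTensor fun p => (M p).kraus (o p) (j p))ᴴ *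
        (localTensor fun p => (M p).kraus (o p) (j p)) = 1 := by
  simp only [localTensor_conjTranspose, localTensor_mul]
  have h (o : ∀ p, Fin (M p).outcomes) := sum_localTensor
    (fun p (j : Fin (M p).rank) => ((M p).kraus (o p) j)ᴴ * (M p).kraus (o p) j)
  simp only [h]
  rw [sum_localTensor
    (fun p (o : Fin (M p).outcomes) => ∑ j, ((M p).kraus o j)ᴴ * (M p).kraus o j)]
  simp only [Instrument.complete, localTensor_one]

end LocalTensor

/-- An LOCC map is separable: it has a Kraus representation by product operators. -/
theorem IsLOCC.exists_product_kraus {P : Type} [Fintype P] [DecidableEq P]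
    {K : P → Type} [∀ p, Fintype (K p)] [∀ p, DecidableEq (K p)]
    {H : P → Type} [∀ p, Fintype (H p)] [∀ p, DecidableEq (H p)]
    {Γ : Matrix (∀ p, H p) (∀ p, H p) ℂ → Matrix (∀ p, K p) (∀ p, K p) ℂ}
    (h : IsLOCC K H Γ) :
    ∃ (ι : Type) (_ : Fintype ι) (A : ι → ∀ p, Matrix (K p) (H p) ℂ),
      (∀ ρ, Γ ρ = ∑ m, localTensor (A m) * ρ * (localTensor (A m))ᴴ) ∧
      ∑ m, (localTensor (A m))ᴴ * localTensor (A m) = 1 := by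
  induction h with
  | done =>
    refine ⟨Unit, inferInstance, fun _ p => 1, fun ρ => ?_, ?_⟩ <;> simp [localTensor_one]
  | round M Γ hΓ ih =>
    choose ι hι A hA hc using ih
    -- A Kraus operator of the composite is indexed by the outcomes of the round, a Kraus index of
    -- the continuation and a local Kraus index for each party.
    refine ⟨Σ o, ι o × (∀ p, Fin (M p).rank), inferInstance,
      fun m p => A m.1 m.2.1 p * (M p).kraus (m.1 p) (m.2.2 p), fun ρ => ?_, ?_⟩
    · rw [Fintype.sum_sigma]
      refine Finset.sum_congr rfl fun o _ => ?_
      rw [hA, Fintype.sum_prod_type]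
      refine Finset.sum_congr rfl fun m _ => ?_
      rw [jointOutcomeMap, Matrix.mul_sum, Matrix.sum_mul]
      refine Finset.sum_congr rfl fun j _ => ?_
      simp only [← localTensor_mul, Matrix.conjTranspose_mul, Matrix.mul_assoc]
    · rw [Fintype.sum_sigma, ← sum_jointKraus_complete M]
      refine Finset.sum_congr rfl fun o _ => ?_
      rw [Fintype.sum_prod_type, Finset.sum_comm]
      refine Finset.sum_congr rfl fun j _ => ?_
      simp only [← localTensor_mul, Matrix.conjTranspose_mul]
      calc _ = (localTensor fun p => (M p).kraus (o p) (j p))ᴴ *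
          (∑ m, (localTensor (A o m))ᴴ * localTensor (A o m)) *
            (localTensor fun p => (M p).kraus (o p) (j p)) := by
            simp only [Matrix.mul_sum, Matrix.sum_mul, Matrix.mul_assoc]
        _ = _ := by rw [hc, Matrix.mul_one]

/-! ### Kraus operators of a map that acts as a unitary -/

theorem dotProduct_ketbra_mulVec {ι : Type} [Fintype ι] (φ χ : ι → ℂ) :
    star χ ⬝ᵥ (ketbra φ *ᵥ χ) = ((‖star χ ⬝ᵥ φ‖ ^ 2 : ℝ) : ℂ) := by
  have h : star (star χ ⬝ᵥ φ) = star φ ⬝ᵥ χ := by rw [← Matrix.star_dotProduct]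
  have h2 : ((‖star χ ⬝ᵥ φ‖ ^ 2 : ℝ) : ℂ) = star χ ⬝ᵥ φ * star (star χ ⬝ᵥ φ) := by
    push_cast; exact (Complex.mul_conj' _).symm
  rw [ketbra, Matrix.vecMulVec_mulVec, h2, h, op_smul_eq_smul, dotProduct_smul, smul_eq_mul,
    mul_comm]

/-- If a completely positive map sends every pure state `ψ` to the pure state `U ψ`, then all its
Kraus operators are multiples of `U`. -/
theorem exists_smul_of_sum_ketbra {ι σ : Type} [Fintype ι] [DecidableEq ι] [Nonempty ι]
    [Fintype σ] (Y : σ → Matrix ι ι ℂ) (U : Matrix ι ι ℂ) (hU : U ∈ Matrix.unitaryGroup ι ℂ)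
    (h : ∀ ψ : ι → ℂ, star ψ ⬝ᵥ ψ = 1 → ∑ m, ketbra (Y m *ᵥ ψ) = ketbra (U *ᵥ ψ)) :
    ∃ c : σ → ℂ, (∀ m, Y m = c m • U) ∧ ∑ m, ‖c m‖ ^ 2 = 1 := by
  have hUU : Uᴴ * U = 1 := Matrix.mem_unitaryGroup_iff'.1 hU
  have hUU' : U * Uᴴ = 1 := Matrix.mem_unitaryGroup_iff.1 hU
  set Z : σ → Matrix ι ι ℂ := fun m => Uᴴ * Y m with hZ
  have key : ∀ ψ χ : ι → ℂ, star ψ ⬝ᵥ ψ = 1 →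
      ∑ m, ‖star χ ⬝ᵥ (Z m *ᵥ ψ)‖ ^ 2 = ‖star χ ⬝ᵥ ψ‖ ^ 2 := by
    intro ψ χ hψ
    have h1 := congrArg (fun A => star (U *ᵥ χ) ⬝ᵥ (A *ᵥ (U *ᵥ χ))) (h ψ hψ)
    simp only [Matrix.sum_mulVec, dotProduct_sum, dotProduct_ketbra_mulVec] at h1
    have h2 (A : Matrix ι ι ℂ) :
        star (U *ᵥ χ) ⬝ᵥ (A *ᵥ ψ) = star χ ⬝ᵥ ((Uᴴ * A) *ᵥ ψ) := by
      rw [Matrix.star_mulVec, ← Matrix.dotProduct_mulVec, Matrix.mulVec_mulVec]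
    simp only [h2, hUU, Matrix.one_mulVec] at h1
    exact_mod_cast h1
  have orth : ∀ ψ χ : ι → ℂ, star ψ ⬝ᵥ ψ = 1 → star χ ⬝ᵥ ψ = 0 → ∀ m,
      star χ ⬝ᵥ (Z m *ᵥ ψ) = 0 := by
    intro ψ χ hψ hχ m
    have h1 := key ψ χ hψ
    rw [hχ, norm_zero, zero_pow two_ne_zero,
      Finset.sum_eq_zero_iff_of_nonneg fun _ _ => by positivity] at h1
    simpa using h1 m (Finset.mem_univ m)
  have hunit (x : ι) : star (Pi.single x (1 : ℂ)) ⬝ᵥ Pi.single x 1 = 1 := by simp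
  have hoff : ∀ m x y, y ≠ x → Z m y x = 0 := by
    intro m x y hxy
    have := orth (Pi.single x 1) (Pi.single y 1) (hunit x) (by simp [hxy]) m
    simpa using this
  have hdiag : ∀ m x y, Z m x x = Z m y y := by
    intro m x y
    by_cases hxy : x = y
    · rw [hxy]
    have hyx : y ≠ x := fun h => hxy h.symm
    -- With the off-diagonal entries gone, this rational unit vector and a vector orthogonal to it
    -- give `(12 / 5) * (Z m x x - Z m y y) = 0`.
    have := orth (Pi.single x (3 / 5) + Pi.single y (4 / 5)) (Pi.single x 4 + Pi.single y (-3))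
      (by simp [hxy, hyx]; norm_num) (by simp [hxy, hyx]; norm_num) m
    simp [Matrix.mulVec_add, add_dotProduct, dotProduct_add, hoff m x y hyx, hoff m y x hxy]
      at this
    linear_combination (5 / 12) * this
  obtain ⟨x₀⟩ := ‹Nonempty ι›
  have hZs (m : σ) : Z m = Z m x₀ x₀ • (1 : Matrix ι ι ℂ) := by
    ext x y
    by_cases hxy : x = y
    · subst hxy; simpa using hdiag m x x₀
    · simp [hxy, hoff m y x hxy]
  refine ⟨fun m => Z m x₀ x₀, fun m => ?_, ?_⟩
  · have : Y m = U * Z m := by rw [hZ, ← Matrix.mul_assoc, hUU', Matrix.one_mul]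
    rw [this, hZs m]
    simp
  · have := key (Pi.single x₀ 1) (Pi.single x₀ 1) (hunit x₀)
    simpa using this

/-! ### AM-GM for singular values and its equality case -/

section AmGm

open scoped ComplexOrder

variable {ι : Type} [Fintype ι] [DecidableEq ι]

/-- The square of the Frobenius norm. -/
noncomputable def frobeniusSq {α β : Type} [Fintype α] [Fintype β] (W : Matrix α β ℂ) : ℝ :=
  ∑ i, ∑ j, ‖W i j‖ ^ 2

/-- The geometric mean of the squares of the singular values. -/
noncomputable def detRoot (W : Matrix ι ι ℂ) : ℝ :=
  (‖W.det‖ ^ 2) ^ ((Fintype.card ι : ℝ)⁻¹)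

theorem detRoot_nonneg (W : Matrix ι ι ℂ) : 0 ≤ detRoot W := by
  unfold detRoot; positivity

omit [DecidableEq ι] in
theorem trace_conjTranspose_mul_self_eq (W : Matrix ι ι ℂ) :
    (Wᴴ * W).trace = (frobeniusSq W : ℂ) := by
  simp only [Matrix.trace, Matrix.diag, Matrix.mul_apply, Matrix.conjTranspose_apply, frobeniusSq]
  rw [Finset.sum_comm]
  push_cast
  refine Finset.sum_congr rfl fun i _ => Finset.sum_congr rfl fun j _ => ?_
  exact Complex.conj_mul' _

theorem sum_eigenvalues_eq (W : Matrix ι ι ℂ) :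
    ∑ i, (Matrix.isHermitian_conjTranspose_mul_self W).eigenvalues i = frobeniusSq W := by
  have := (Matrix.isHermitian_conjTranspose_mul_self W).trace_eq_sum_eigenvalues
  rw [trace_conjTranspose_mul_self_eq] at this
  refine Complex.ofReal_injective (this.trans ?_).symm
  simp

theorem prod_eigenvalues_eq (W : Matrix ι ι ℂ) :
    ∏ i, (Matrix.isHermitian_conjTranspose_mul_self W).eigenvalues i = ‖W.det‖ ^ 2 := by
  have := (Matrix.isHermitian_conjTranspose_mul_self W).det_eq_prod_eigenvalues
  rw [Matrix.det_mul, Matrix.det_conjTranspose] at this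
  have h2 : star W.det * W.det = ((‖W.det‖ ^ 2 : ℝ) : ℂ) := by
    push_cast; exact Complex.conj_mul' _
  rw [h2] at this
  refine Complex.ofReal_injective (this.trans ?_).symm
  simp

theorem detRoot_eq_prod (W : Matrix ι ι ℂ) :
    detRoot W = ∏ i, (Matrix.isHermitian_conjTranspose_mul_self W).eigenvalues i ^
      ((Fintype.card ι : ℝ)⁻¹) := by
  rw [Real.finsetProd_rpow _ _
    fun i _ => (Matrix.posSemidef_conjTranspose_mul_self W).eigenvalues_nonneg i,
    prod_eigenvalues_eq, detRoot]

variable [Nonempty ι]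

theorem card_mul_detRoot_le (W : Matrix ι ι ℂ) :
    Fintype.card ι * detRoot W ≤ frobeniusSq W := by
  have hd : (0 : ℝ) < Fintype.card ι := by exact_mod_cast Fintype.card_pos
  have := Real.geom_mean_le_arith_mean_weighted Finset.univ
    (fun _ : ι => (Fintype.card ι : ℝ)⁻¹)
    (Matrix.isHermitian_conjTranspose_mul_self W).eigenvalues (fun _ _ => by positivity)
    (by simp [hd.ne'])
    (fun i _ => (Matrix.posSemidef_conjTranspose_mul_self W).eigenvalues_nonneg i)
  rw [← detRoot_eq_prod, ← Finset.mul_sum, sum_eigenvalues_eq] at this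
  calc _ ≤ Fintype.card ι * ((Fintype.card ι : ℝ)⁻¹ * frobeniusSq W) := by gcongr
    _ = _ := by field_simp

/-- Equality in AM-GM makes all eigenvalues of the Hermitian matrix `Wᴴ * W` equal, so by the
spectral theorem it is scalar. -/
theorem conjTranspose_mul_self_of_card_mul_detRoot_eq (W : Matrix ι ι ℂ)
    (h : Fintype.card ι * detRoot W = frobeniusSq W) :
    Wᴴ * W = (detRoot W : ℂ) • (1 : Matrix ι ι ℂ) := by
  have hd : (0 : ℝ) < Fintype.card ι := by exact_mod_cast Fintype.card_pos
  have hiff := Real.geom_mean_eq_arith_mean_weighted_iff_of_pos' Finset.univ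
    (fun _ : ι => (Fintype.card ι : ℝ)⁻¹)
    (Matrix.isHermitian_conjTranspose_mul_self W).eigenvalues (fun _ _ => by positivity)
    (by simp [hd.ne'])
    (fun i _ => (Matrix.posSemidef_conjTranspose_mul_self W).eigenvalues_nonneg i)
  rw [← detRoot_eq_prod, ← Finset.mul_sum, sum_eigenvalues_eq, ← h,
    inv_mul_cancel_left₀ hd.ne'] at hiff
  have hev := hiff.1 rfl
  have hs := (Matrix.isHermitian_conjTranspose_mul_self W).spectral_theorem
  have hD : Matrix.diagonal (RCLike.ofReal ∘
      (Matrix.isHermitian_conjTranspose_mul_self W).eigenvalues) =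
      (detRoot W : ℂ) • (1 : Matrix ι ι ℂ) := by
    rw [Matrix.smul_one_eq_diagonal]
    congr 1
    funext i
    simp [hev i (Finset.mem_univ i)]
  rw [hD, map_smul, map_one] at hs
  exact hs

theorem detRoot_smul_unitary (c : ℂ) {U : Matrix ι ι ℂ} (hU : U ∈ Matrix.unitaryGroup ι ℂ) :
    detRoot (c • U) = ‖c‖ ^ 2 := by
  have hdet : ‖U.det‖ = 1 :=
    CStarRing.norm_of_mem_unitary (Matrix.det_of_mem_unitary hU)
  rw [detRoot, Matrix.det_smul, norm_mul, norm_pow, hdet, mul_one, ← pow_mul, mul_comm, pow_mul]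
  exact Real.pow_rpow_inv_natCast (by positivity) Fintype.card_ne_zero

omit [Nonempty ι] in
theorem detRoot_prod_ofFn {n : ℕ} (W : Fin n → Matrix ι ι ℂ) :
    detRoot (List.ofFn W).prod = ∏ j, detRoot (W j) := by
  have : (List.ofFn W).prod.det = ∏ j, (W j).det := by
    rw [← Matrix.coe_detMonoidHom, map_list_prod, List.map_ofFn, List.prod_ofFn]
    rfl
  simp only [detRoot]
  rw [this, norm_prod, ← Finset.prod_pow, Real.finsetProd_rpow _ _ fun i _ => by positivity]

/-- The equality case of the AM-GM inequality for a family of products of matrices. -/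
theorem conjTranspose_mul_self_of_sum_prod_frobeniusSq {σ : Type} [Fintype σ] {n : ℕ}
    (W : σ → Fin n → Matrix ι ι ℂ) {U : Matrix ι ι ℂ} (hU : U ∈ Matrix.unitaryGroup ι ℂ)
    (c : σ → ℂ) (hprod : ∀ m, (List.ofFn (W m)).prod = c m • U)
    (hsum : ∑ m, ∏ j, frobeniusSq (W m j) = (Fintype.card ι : ℝ) ^ n * ∑ m, ‖c m‖ ^ 2)
    (m : σ) (hm : c m ≠ 0) (j : Fin n) :
    0 < detRoot (W m j) ∧ (W m j)ᴴ * W m j = (detRoot (W m j) : ℂ) • (1 : Matrix ι ι ℂ) := by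
  have hd : (0 : ℝ) < Fintype.card ι := by exact_mod_cast Fintype.card_pos
  have hroot (m : σ) : ∏ j, detRoot (W m j) = ‖c m‖ ^ 2 := by
    rw [← detRoot_prod_ofFn, hprod, detRoot_smul_unitary _ hU]
  have hle (m : σ) : ∏ j, (Fintype.card ι * detRoot (W m j)) ≤ ∏ j, frobeniusSq (W m j) :=
    Finset.prod_le_prod (fun j _ => mul_nonneg hd.le (detRoot_nonneg _))
      fun j _ => card_mul_detRoot_le _
  have hsum' : ∑ m, ∏ j, (Fintype.card ι * detRoot (W m j)) =
      ∑ m, ∏ j, frobeniusSq (W m j) := by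
    rw [hsum, Finset.mul_sum]
    simp [Finset.prod_mul_distrib, hroot]
  have heq := (Finset.sum_eq_sum_iff_of_le fun m _ => hle m).1 hsum' m (Finset.mem_univ m)
  have hpos (j : Fin n) : 0 < detRoot (W m j) := by
    refine (detRoot_nonneg _).lt_of_ne' fun h0 => ?_
    have h1 := hroot m
    rw [Finset.prod_eq_zero (Finset.mem_univ j) h0] at h1
    exact hm (by simpa using h1.symm)
  refine ⟨hpos j, conjTranspose_mul_self_of_card_mul_detRoot_eq _ ?_⟩
  -- All the lower bounds are positive, so one strict factor would make the whole product inequality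
  -- strict.
  by_contra hne
  refine (Finset.prod_lt_prod (s := Finset.univ) (fun j _ => mul_pos hd (hpos j))
    (fun j _ => card_mul_detRoot_le (W m j))
    ⟨j, Finset.mem_univ j, lt_of_le_of_ne (card_mul_detRoot_le _) hne⟩).ne heq

/-- A unitary which is a multiple of a product of multiples of unitaries is a product of
unitaries proportional to the factors. -/
theorem exists_unitary_factors {n : ℕ} (W : Fin (n + 1) → Matrix ι ι ℂ) {U : Matrix ι ι ℂ}
    (hU : U ∈ Matrix.unitaryGroup ι ℂ) (a : ℂ) (hprod : U = a • (List.ofFn W).prod)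
    (hW : ∀ j, ∃ t : ℝ, 0 < t ∧ (W j)ᴴ * W j = (t : ℂ) • (1 : Matrix ι ι ℂ)) :
    ∃ V : Fin (n + 1) → Matrix ι ι ℂ,
      (∀ j, V j ∈ Matrix.unitaryGroup ι ℂ ∧ ∃ s : ℂ, V j = s • W j) ∧
      U = (List.ofFn V).prod := by
  choose t ht hWt using hW
  have hV (j : Fin (n + 1)) : ((√(t j))⁻¹ : ℂ) • W j ∈ Matrix.unitaryGroup ι ℂ := by
    rw [Matrix.mem_unitaryGroup_iff', star_smul, smul_mul_smul_comm, Matrix.star_eq_conjTranspose,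
      hWt, smul_smul]
    have h1 : (√(t j) : ℂ) * √(t j) = t j := by exact_mod_cast Real.mul_self_sqrt (ht j).le
    have h2 : (√(t j) : ℂ) ≠ 0 := by exact_mod_cast (Real.sqrt_pos.2 (ht j)).ne'
    have h3 : star ((√(t j))⁻¹ : ℂ) * ((√(t j))⁻¹ : ℂ) * (t j : ℂ) = 1 := by
      rw [← h1]; simp; field_simp
    rw [h3, one_smul]
  have hsm : ∀ {n : ℕ} (s : Fin n → ℂ) (W : Fin n → Matrix ι ι ℂ),
      (List.ofFn fun j => s j • W j).prod = (∏ j, s j) • (List.ofFn W).prod := by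
    intro n
    induction n with
    | zero => intro s W; simp
    | succ n ih =>
      intro s W
      rw [List.ofFn_succ, List.prod_cons, ih, List.ofFn_succ, List.prod_cons,
        smul_mul_smul_comm, Fin.prod_univ_succ]
  set P := (List.ofFn fun j => ((√(t j))⁻¹ : ℂ) • W j).prod with hP
  have hPU : P ∈ Matrix.unitaryGroup ι ℂ := by
    refine Submonoid.list_prod_mem _ fun x hx => ?_
    obtain ⟨j, rfl⟩ := (List.mem_ofFn' _ _).1 hx
    exact hV j
  obtain ⟨β, hβ⟩ : ∃ β : ℂ, U = β • P := by
    refine ⟨a * ∏ j, (√(t j) : ℂ), ?_⟩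
    rw [hP, hsm, smul_smul, hprod, mul_assoc, ← Finset.prod_mul_distrib, Finset.prod_eq_one,
      mul_one]
    intro j _
    exact mul_inv_cancel₀ (by exact_mod_cast (Real.sqrt_pos.2 (ht j)).ne')
  have hββ : star β * β = 1 := by
    have h1 := Matrix.mem_unitaryGroup_iff'.1 hU
    rw [hβ, star_smul, smul_mul_smul_comm, Matrix.mem_unitaryGroup_iff'.1 hPU] at h1
    obtain ⟨i⟩ := ‹Nonempty ι›
    simpa using congrFun (congrFun h1 i) i
  -- The leftover phase `β` is absorbed into the first factor.
  refine ⟨fun j => (if j = 0 then β else 1) • ((√(t j))⁻¹ : ℂ) • W j, fun j => ⟨?_, ?_⟩, ?_⟩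
  · rw [Matrix.mem_unitaryGroup_iff', star_smul, smul_mul_smul_comm,
      Matrix.mem_unitaryGroup_iff'.1 (hV j)]
    split_ifs
    · rw [hββ, one_smul]
    · simp
  · exact ⟨_, smul_smul _ _ _⟩
  · rw [hsm, ← hP, hβ]
    simp

end AmGm

/-- The distribution of a bit string of all the qubits over the nodes. -/
def splitBits {Q V : Type} (loc : Q → V) (b : Q → Fin 2) : ∀ v, LocalBasis loc v :=
  fun _ q => b q.1

/-- Bit strings of all the qubits correspond to products of local basis vectors. -/
def splitBitsEquiv {Q V : Type} (loc : Q → V) : (Q → Fin 2) ≃ (∀ v, LocalBasis loc v) where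
  toFun := splitBits loc
  invFun := joinBits loc
  left_inv _ := rfl
  right_inv x := by
    funext v ⟨q, hq⟩
    subst hq
    rfl

/-! ### Column operators and chain form -/

section Column

variable {k N : ℕ}

/-- The bit of an initial qubit at a node whose left, right, upper and lower edges carry the bits
`l`, `r`, `u` and `d`. -/
def portBit (l r u d : Fin 2) : InitialQubit k N → Fin 2
  | Sum.inl _ => l
  | Sum.inr (Sum.inl _, t) => if t = 0 then d else u
  | Sum.inr (Sum.inr _, t) => if t = 0 then r else l

/-- The entry of a local operator as a function of the bits on the left, right, upper and lower
edges of the node. -/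
def nodeTensor (hN : 1 ≤ N)
    (A : ∀ v, Matrix (LocalBasis (outputNode (k := k) hN) v)
      (LocalBasis (initialNode (k := k) hN) v) ℂ)
    (v : ClusterNode k N) (l r u d : Fin 2) : ℂ :=
  A v (fun _ => r) (fun q => portBit l r u d q.1)

/-- The bit on the edge above the `i`-th node of a column. -/
def upperBit (s : Fin (k - 1) → Fin 2) (i : Fin k) : Fin 2 :=
  if h : 0 < i.val then s ⟨i.val - 1, by omega⟩ else 0

/-- The bit on the edge below the `i`-th node of a column. -/
def lowerBit (s : Fin (k - 1) → Fin 2) (i : Fin k) : Fin 2 :=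
  if h : i.val + 1 < k then s ⟨i.val, by omega⟩ else 0

/-- The contraction of the local operators of a column over its vertical edges. -/
noncomputable def columnOperator (hN : 1 ≤ N)
    (A : ∀ v, Matrix (LocalBasis (outputNode (k := k) hN) v)
      (LocalBasis (initialNode (k := k) hN) v) ℂ)
    (j : Fin N) : Matrix (Fin k → Fin 2) (Fin k → Fin 2) ℂ :=
  Matrix.of fun r l => ∑ s : Fin (k - 1) → Fin 2,
    ∏ i, nodeTensor hN A (i, j) (l i) (r i) (upperBit s i) (lowerBit s i)

theorem hasChainForm_smul_columnOperator (hk : 2 ≤ k) (hN : 1 ≤ N)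
    (A : ∀ v, Matrix (LocalBasis (outputNode (k := k) hN) v)
      (LocalBasis (initialNode (k := k) hN) v) ℂ)
    (j : Fin N) (c : ℂ) : HasChainForm (c • columnOperator hN A j) := by
  let i₀ : Fin k := ⟨0, by omega⟩
  refine ⟨fun a => Matrix.of fun r l => c * nodeTensor hN A (i₀, j) l r 0 a,
    fun a => Matrix.of fun r l => nodeTensor hN A (⟨k - 1, by omega⟩, j) l r a 0,
    fun q a b => Matrix.of fun r l => nodeTensor hN A (q, j) l r a b, ?_⟩
  ext r l
  simp only [Matrix.smul_apply, columnOperator, Matrix.of_apply, Matrix.sum_apply, localTensor,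
    smul_eq_mul, Finset.mul_sum]
  refine Finset.sum_congr rfl fun s _ => ?_
  -- The scalar is spread over the product so that it lands in the top node's factor.
  have hc : c = ∏ i : Fin k, if i = i₀ then c else 1 := by simp
  conv_lhs => rw [hc]
  rw [← Finset.prod_mul_distrib]
  refine Finset.prod_congr rfl fun i _ => ?_
  by_cases hl : 0 < i.val
  · have hi : i ≠ i₀ := fun h => by simp [h, i₀] at hl
    by_cases hr : i.val + 1 < k
    · simp [chainFactor, upperBit, lowerBit, hl, hr, hi]
    · have hik : i = ⟨k - 1, by omega⟩ := Fin.ext (by simp; omega)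
      simp only [chainFactor, upperBit, lowerBit, hl, hr, hi, if_false, dif_pos, dif_neg,
        not_false_eq_true, one_mul, Matrix.of_apply]
      rw [← hik]
  · have hi : i = i₀ := Fin.ext (by simp [i₀]; omega)
    have hr : i.val + 1 < k := by omega
    simp only [chainFactor, upperBit, lowerBit, hl, hr, dif_pos, dif_neg, not_false_eq_true,
      Matrix.of_apply, if_pos hi]
    rw [← hi]

end Column

/-! ### Contraction of the network with the resource state -/

section Contraction

variable {k n : ℕ}

/-- The bits of the initial qubits when the left and right horizontal bits at the nodes are given by
`l` and `h`, and both ends of each vertical edge carry the bit given by `s`. -/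
def networkBits (l : Fin (n + 1) → Fin k → Fin 2) (h : Fin n → Fin k → Fin 2)
    (s : Fin (n + 1) → Fin (k - 1) → Fin 2) : InitialQubit k (n + 1) → Fin 2
  | Sum.inl i => l 0 i
  | Sum.inr (Sum.inl (i, j), _) => s j i
  | Sum.inr (Sum.inr (i, j), t) => if t = 0 then h j i else l (Fin.succ j) i

theorem localTensor_splitBits_networkBits (hN : 1 ≤ n + 1)
    (A : ∀ v, Matrix (LocalBasis (outputNode (k := k) hN) v)
      (LocalBasis (initialNode (k := k) hN) v) ℂ)
    (l : Fin (n + 1) → Fin k → Fin 2) (h : Fin n → Fin k → Fin 2) (y : Fin k → Fin 2)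
    (s : Fin (n + 1) → Fin (k - 1) → Fin 2) :
    localTensor A (splitBits _ y) (splitBits _ (networkBits l h s)) =
      ∏ j, ∏ i, nodeTensor hN A (i, j) (l j i)
        ((Fin.snoc h y : Fin (n + 1) → Fin k → Fin 2) j i) (upperBit (s j) i)
        (lowerBit (s j) i) := by
  rw [localTensor, Matrix.of_apply, Fintype.prod_prod_type_right]
  refine Finset.prod_congr rfl fun j _ => Finset.prod_congr rfl fun i _ => ?_
  unfold nodeTensor
  congr 1
  -- Only nodes of the last column hold an output qubit, and there the right bit is the output bit
  -- `y`. At other nodes the output basis has one point, so nothing is to be checked.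
  · funext ⟨q, hq⟩
    have hi : q = i := congrArg Prod.fst hq
    have hj : Fin.last n = j := congrArg Prod.snd hq
    subst hi hj
    simp [splitBits]
  · funext ⟨q, hq⟩
    rcases q with q | ⟨⟨a, b⟩ | ⟨a, b⟩, t⟩
    · have hi : q = i := congrArg Prod.fst hq
      have hj : (0 : Fin (n + 1)) = j := congrArg Prod.snd hq
      subst hi hj
      rfl
    · have hi := congrArg (fun v => v.1.val) hq
      have hj : b = j := congrArg Prod.snd hq
      subst hj
      obtain rfl | rfl : t = 0 ∨ t = 1 := by omega
      · have hi : a.val = i.val := by simpa [initialNode, ClusterEdge.endpoint] using hi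
        have : i.val + 1 < k := by omega
        have hai : a = ⟨i.val, by omega⟩ := Fin.ext hi
        simp [splitBits, networkBits, portBit, lowerBit, this, hai]
      · have hi : a.val + 1 = i.val := by simpa [initialNode, ClusterEdge.endpoint] using hi
        simp [splitBits, networkBits, portBit, upperBit, ← hi]
    · have hi : a = i := congrArg Prod.fst hq
      have hj := congrArg (fun v => v.2.val) hq
      subst hi
      obtain rfl | rfl : t = 0 ∨ t = 1 := by omega
      · have hj : j = Fin.castSucc (n := n) b := by
          refine Fin.ext ?_
          simpa [initialNode, ClusterEdge.endpoint] using hj.symm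
        subst hj
        have := congrFun (Fin.snoc_castSucc (α := fun _ => Fin k → Fin 2) y h b) a
        simp only [splitBits, networkBits, portBit, if_true]
        exact this.symm
      · have hj : j = Fin.succ (n := n) b := by
          refine Fin.ext ?_
          simpa [initialNode, ClusterEdge.endpoint] using hj.symm
        subst hj
        simp [splitBits, networkBits, portBit]

theorem sum_localTensor_networkBits (hN : 1 ≤ n + 1)
    (A : ∀ v, Matrix (LocalBasis (outputNode (k := k) hN) v)
      (LocalBasis (initialNode (k := k) hN) v) ℂ)
    (l : Fin (n + 1) → Fin k → Fin 2) (h : Fin n → Fin k → Fin 2) (y : Fin k → Fin 2) :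
    ∑ s, localTensor A (splitBits _ y) (splitBits _ (networkBits l h s)) =
      ∏ j, columnOperator hN A j ((Fin.snoc h y : Fin (n + 1) → Fin k → Fin 2) j) (l j) := by
  simp only [localTensor_splitBits_networkBits, columnOperator, Matrix.of_apply]
  rw [prod_sum_eq_sum_prod_pi]

/-- The entries of a matrix product as a sum over paths. -/
theorem prod_ofFn_rev_apply {ι : Type} [Fintype ι] [DecidableEq ι] :
    ∀ {n : ℕ} (W : Fin (n + 1) → Matrix ι ι ℂ) (y z : ι),
      (List.ofFn fun j => W (Fin.rev j)).prod y z =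
        ∑ h : Fin n → ι, ∏ j, W j ((Fin.snoc h y : Fin (n + 1) → ι) j)
          ((Fin.cons z h : Fin (n + 1) → ι) j) := by
  intro n
  induction n with
  | zero => intro W y z; simp [Fin.snoc]
  | succ n ih =>
    intro W y z
    rw [List.ofFn_succ, List.prod_cons, Matrix.mul_apply,
      ← (Fin.snocEquiv fun _ : Fin (n + 1) => ι).sum_comp, Fintype.sum_prod_type]
    refine Finset.sum_congr rfl fun x _ => ?_
    have := ih (fun j => W j.castSucc) x z
    simp only [← Fin.rev_succ] at this
    rw [this, Finset.mul_sum]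
    refine Finset.sum_congr rfl fun h _ => ?_
    rw [Fin.prod_univ_castSucc (n := n + 1), mul_comm]
    have h1 (i : Fin (n + 1)) : (Fin.cons z (Fin.snoc h x : Fin (n + 1) → ι) :
        Fin (n + 2) → ι) i.castSucc = (Fin.cons z h : Fin (n + 1) → ι) i := by
      rw [Fin.cons_snoc_eq_snoc_cons, Fin.snoc_castSucc]
    simp only [Fin.snocEquiv, Equiv.coe_fn_mk, h1, Fin.snoc_castSucc, Fin.snoc_last]
    simp [← Fin.succ_last]

/-- The normalization factor of the resource state. -/
noncomputable def eprScale (k N : ℕ) : ℂ :=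
  ((1 / Real.sqrt 2 : ℝ) : ℂ) ^ Fintype.card (ClusterEdge k N)

/-- The operator from the input qubits to the output qubits obtained from local operators at
the nodes and the resource state. -/
noncomputable def networkOperator (hN : 1 ≤ n + 1)
    (A : ∀ v, Matrix (LocalBasis (outputNode (k := k) hN) v)
      (LocalBasis (initialNode (k := k) hN) v) ℂ) :
    Matrix (Fin k → Fin 2) (Fin k → Fin 2) ℂ :=
  eprScale k (n + 1) • (List.ofFn fun j => columnOperator hN A (Fin.rev j)).prod

/-- The resource state is constant on its support, the strings whose two bits agree on each edge.
Agreement on horizontal edges makes the left bits of a column the right bits of the previous one,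
hence `Fin.cons z h`. -/
theorem sum_mul_resourceState (G : (InitialQubit k (n + 1) → Fin 2) → ℂ) :
    ∑ b, G b * resourceState k (n + 1) (fun r => b (Sum.inr r)) =
      ∑ z, ∑ h, ∑ s, G (networkBits (Fin.cons z h) h s) * eprScale k (n + 1) := by
  symm
  calc _ = ∑ p : ((Fin k → Fin 2) × (Fin n → Fin k → Fin 2)) ×
        (Fin (n + 1) → Fin (k - 1) → Fin 2),
        G (networkBits (Fin.cons p.1.1 p.1.2) p.1.2 p.2) * eprScale k (n + 1) := by
        rw [Fintype.sum_prod_type, Fintype.sum_prod_type]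
    _ = _ := ?_
  refine Fintype.sum_of_injective
    (fun p : ((Fin k → Fin 2) × (Fin n → Fin k → Fin 2)) ×
        (Fin (n + 1) → Fin (k - 1) → Fin 2) =>
      networkBits (Fin.cons p.1.1 p.1.2) p.1.2 p.2) ?_ _ _ ?_ ?_
  · rintro ⟨⟨z, h⟩, s⟩ ⟨⟨z', h'⟩, s'⟩ hb
    simp only [Prod.mk.injEq]
    refine ⟨⟨?_, ?_⟩, ?_⟩
    · funext i
      exact congrFun hb (Sum.inl i)
    · funext j i
      exact congrFun hb (Sum.inr (Sum.inr (i, j), 0))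
    · funext j i
      exact congrFun hb (Sum.inr (Sum.inl (i, j), 0))
  · intro b hb
    by_contra hne
    refine hb ⟨((fun i => b (Sum.inl i), fun j i => b (Sum.inr (Sum.inr (i, j), 0))),
      fun j i => b (Sum.inr (Sum.inl (i, j), 0))), ?_⟩
    have hE (e : ClusterEdge k (n + 1)) : b (Sum.inr (e, 0)) = b (Sum.inr (e, 1)) := by
      by_contra he
      refine hne (mul_eq_zero_of_right _ ?_)
      exact Finset.prod_eq_zero (Finset.mem_univ e) (if_neg he)
    funext q
    rcases q with q | ⟨⟨a, j⟩ | ⟨a, j⟩, t⟩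
    · rfl
    · obtain rfl | rfl : t = 0 ∨ t = 1 := by omega
      · rfl
      · exact hE _
    · obtain rfl | rfl : t = 0 ∨ t = 1 := by omega
      · rfl
      · exact hE _
  · rintro ⟨⟨z, h⟩, s⟩
    simp only
    congr 1
    rw [resourceState, eprScale, Finset.prod_congr rfl (g := fun _ => ((1 / √2 : ℝ) : ℂ))]
    · simp
    · rintro (⟨a, j⟩ | ⟨a, j⟩) _
      · exact if_pos rfl
      · exact if_pos rfl

theorem localTensor_mulVec_initialKet (hN : 1 ≤ n + 1)
    (A : ∀ v, Matrix (LocalBasis (outputNode (k := k) hN) v)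
      (LocalBasis (initialNode (k := k) hN) v) ℂ) (ψ : (Fin k → Fin 2) → ℂ) :
    localTensor A *ᵥ initialKet hN ψ = outputKet hN (networkOperator hN A *ᵥ ψ) := by
  funext x
  obtain ⟨y, rfl⟩ := (splitBitsEquiv _).surjective x
  change ∑ x', localTensor A (splitBits _ y) x' * initialKet hN ψ x' =
    ∑ z, networkOperator hN A y z * ψ z
  rw [← (splitBitsEquiv _).sum_comp]
  have h1 := sum_mul_resourceState (n := n) (k := k) fun b =>
    localTensor A (splitBits _ y) (splitBits (initialNode hN) b) * ψ fun i => b (Sum.inl i)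
  calc _ = _ := Finset.sum_congr rfl fun b _ => (mul_assoc _ _ _).symm
    _ = _ := h1
    _ = _ := by
      refine Finset.sum_congr rfl fun z _ => ?_
      have h2 (h : Fin n → Fin k → Fin 2) (s : Fin (n + 1) → Fin (k - 1) → Fin 2) :
          (fun i => networkBits (Fin.cons z h) h s (Sum.inl i)) = z := rfl
      simp only [h2, ← Finset.sum_mul, sum_localTensor_networkBits]
      -- The order is reversed because the first column acts first and so is the rightmost factor.
      rw [← prod_ofFn_rev_apply, networkOperator, Matrix.smul_apply, smul_eq_mul]
      ring

/-! ### Total Frobenius weight from completeness -/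

/-- Completeness preserves the squared norm of the sum of the distinct basis vectors `e s`, which is
`Fintype.card S`. -/
theorem sum_sum_norm_sq_of_complete {σ α β S : Type} [Fintype σ] [Fintype α] [Fintype β]
    [DecidableEq β] [Fintype S] (B : σ → Matrix α β ℂ) (hB : ∑ m, (B m)ᴴ * B m = 1)
    (e : S → β) (he : Function.Injective e) :
    ∑ m, ∑ x, ‖∑ s, B m x (e s)‖ ^ 2 = Fintype.card S := by
  classical
  have h1 : ∑ m, ∑ x, ((‖∑ s, B m x (e s)‖ ^ 2 : ℝ) : ℂ) =
      ∑ s, ∑ s', (∑ m, (B m)ᴴ * B m) (e s) (e s') := by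
    simp only [Complex.ofReal_pow, ← Complex.conj_mul', map_sum, Finset.sum_mul_sum,
      Matrix.sum_apply, Matrix.mul_apply, Matrix.conjTranspose_apply]
    simp only [Finset.sum_comm (s := (Finset.univ : Finset S)) (t := (Finset.univ : Finset σ)),
      Finset.sum_comm (s := (Finset.univ : Finset S)) (t := (Finset.univ : Finset α))]
    rfl
  rw [hB] at h1
  simp only [Matrix.one_apply, he.eq_iff] at h1
  have h2 : ((∑ m, ∑ x, ‖∑ s, B m x (e s)‖ ^ 2 : ℝ) : ℂ) = (Fintype.card S : ℝ) := by
    push_cast at h1 ⊢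
    rw [h1]
    simp
  exact_mod_cast h2

/-- Expanding the Frobenius norms leaves the left bits `l` and right bits `h`, `y` of the columns
independent, with only vertical edges contracted. For fixed `l` and `h`, the sum over `m` and `y` is
the squared norm of a sum of basis vectors over `s`. -/
theorem sum_prod_frobeniusSq_columnOperator {σ : Type} [Fintype σ] (hN : 1 ≤ n + 1)
    [∀ v, DecidableEq (LocalBasis (initialNode (k := k) hN) v)]
    (A : σ → ∀ v, Matrix (LocalBasis (outputNode (k := k) hN) v)
      (LocalBasis (initialNode (k := k) hN) v) ℂ)
    (hA : ∑ m, (localTensor (A m))ᴴ * localTensor (A m) = 1) :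
    ∑ m, ∏ j, frobeniusSq (columnOperator hN (A m) j) =
      (Fintype.card (Fin k → Fin 2) : ℝ) ^ (n + 1) *
        (Fintype.card (Fin n → Fin k → Fin 2) *
          Fintype.card (Fin (n + 1) → Fin (k - 1) → Fin 2)) := by
  have h1 (m : σ) : ∏ j, frobeniusSq (columnOperator hN (A m) j) =
      ∑ l : Fin (n + 1) → Fin k → Fin 2, ∑ h : Fin n → Fin k → Fin 2, ∑ y : Fin k → Fin 2,
        ‖∑ s, localTensor (A m) (splitBits _ y) (splitBits _ (networkBits l h s))‖ ^ 2 := by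
    simp only [sum_localTensor_networkBits, norm_prod, ← Finset.prod_pow, frobeniusSq]
    have h2 (l : Fin (n + 1) → Fin k → Fin 2) :
        ∑ r : Fin (n + 1) → Fin k → Fin 2, ∏ j, ‖columnOperator hN (A m) j (r j) (l j)‖ ^ 2 =
        ∑ h : Fin n → Fin k → Fin 2, ∑ y : Fin k → Fin 2, ∏ j,
          ‖columnOperator hN (A m) j ((Fin.snoc h y : Fin (n + 1) → Fin k → Fin 2) j)
            (l j)‖ ^ 2 := by
      rw [← (Fin.snocEquiv fun _ => Fin k → Fin 2).sum_comp, Fintype.sum_prod_type_right]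
      rfl
    simp only [← h2]
    rw [Finset.prod_univ_sum, Fintype.piFinset_univ, Finset.sum_comm]
    refine Finset.sum_congr rfl fun r _ => ?_
    rw [Finset.prod_univ_sum, Fintype.piFinset_univ]
  simp only [h1]
  rw [Finset.sum_comm]
  have h3 (l : Fin (n + 1) → Fin k → Fin 2) (h : Fin n → Fin k → Fin 2) :
      ∑ m, ∑ y : Fin k → Fin 2,
        ‖∑ s, localTensor (A m) (splitBits _ y) (splitBits _ (networkBits l h s))‖ ^ 2 =
      Fintype.card (Fin (n + 1) → Fin (k - 1) → Fin 2) := by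
    rw [← sum_sum_norm_sq_of_complete _ hA
      (fun s => splitBits (initialNode hN) (networkBits l h s))]
    · refine Finset.sum_congr rfl fun m _ => ?_
      rw [← (splitBitsEquiv (outputNode hN)).sum_comp]
      rfl
    · intro s s' hs
      funext j i
      exact congrFun ((splitBitsEquiv (initialNode hN)).injective
        (a₁ := networkBits l h s) (a₂ := networkBits l h s') hs)
        (Sum.inr (Sum.inl (i, j), 0))
  have h4 (l : Fin (n + 1) → Fin k → Fin 2) :
      ∑ m, ∑ h : Fin n → Fin k → Fin 2, ∑ y : Fin k → Fin 2,
        ‖∑ s, localTensor (A m) (splitBits _ y) (splitBits _ (networkBits l h s))‖ ^ 2 =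
      Fintype.card (Fin n → Fin k → Fin 2) *
        Fintype.card (Fin (n + 1) → Fin (k - 1) → Fin 2) := by
    rw [Finset.sum_comm]
    simp only [h3]
    simp
  simp only [h4]
  simp

/-- Both sides are 2 to the number of edges: `h` assigns a bit to each horizontal edge and `s` to
each vertical one. This cancels the count obtained from completeness. -/
theorem norm_eprScale_sq :
    (‖eprScale k (n + 1)‖ ^ 2)⁻¹ = (Fintype.card (Fin n → Fin k → Fin 2) : ℝ) *
      Fintype.card (Fin (n + 1) → Fin (k - 1) → Fin 2) := by
  have h : ‖((1 / √2 : ℝ) : ℂ)‖ ^ 2 = 2⁻¹ := by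
    rw [Complex.norm_real, Real.norm_eq_abs, sq_abs, div_pow, Real.sq_sqrt (by norm_num)]
    norm_num
  rw [eprScale, norm_pow, ← pow_mul, mul_comm, pow_mul, h]
  simp only [Fintype.card_sum, Fintype.card_prod, Fintype.card_fin, Fintype.card_fun,
    Nat.add_sub_cancel, Nat.cast_pow, Nat.cast_ofNat]
  rw [inv_pow, inv_inv, pow_add, ← pow_mul, ← pow_mul, mul_comm]

end Contraction

/-! ### The decomposition -/

theorem ketbra_mulVec {α β : Type} [Fintype β] (B : Matrix α β ℂ) (φ : β → ℂ) :
    ketbra (B *ᵥ φ) = B * ketbra φ * Bᴴ := by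
  rw [ketbra, ketbra, Matrix.mul_vecMulVec, Matrix.vecMulVec_mul, Matrix.star_mulVec]

theorem theorem1 (k N : ℕ) (hk : 2 ≤ k) (hN : 1 ≤ N)
    (U : Matrix (Fin k → Fin 2) (Fin k → Fin 2) ℂ)
    (hU : U ∈ Matrix.unitaryGroup (Fin k → Fin 2) ℂ)
    (himp : DeterministicallyImplementable hN U) :
    ∃ V : Fin N → Matrix (Fin k → Fin 2) (Fin k → Fin 2) ℂ,
      (∀ j, V j ∈ Matrix.unitaryGroup (Fin k → Fin 2) ℂ ∧ HasChainForm (V j)) ∧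
      U = (List.ofFn V).prod := by
  obtain ⟨n, rfl⟩ : ∃ n, N = n + 1 := ⟨N - 1, by omega⟩
  obtain ⟨Γ, hΓ, hψ⟩ := himp
  obtain ⟨σ, _, A, hA, hc⟩ := hΓ.exists_product_kraus
  obtain ⟨c, hcU, hc1⟩ := exists_smul_of_sum_ketbra (fun m => networkOperator hN (A m)) U hU (by
    intro ψ h1
    have h2 := hψ ψ h1
    rw [hA] at h2
    simp only [← ketbra_mulVec, localTensor_mulVec_initialKet] at h2
    ext y y'
    have h3 := congrFun (congrFun h2 (splitBits _ y)) (splitBits _ y')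
    rw [Matrix.sum_apply] at h3 ⊢
    exact h3)
  have hα : eprScale k (n + 1) ≠ 0 := by
    refine pow_ne_zero _ ?_
    simp
  have hprod (m : σ) : (List.ofFn fun j => columnOperator hN (A m) (Fin.rev j)).prod =
      ((eprScale k (n + 1))⁻¹ * c m) • U := by
    rw [mul_smul, ← hcU, networkOperator, inv_smul_smul₀ hα]
  have hsum : ∑ m, ∏ j, frobeniusSq (columnOperator hN (A m) (Fin.rev j)) =
      (Fintype.card (Fin k → Fin 2) : ℝ) ^ (n + 1) *
        ∑ m, ‖(eprScale k (n + 1))⁻¹ * c m‖ ^ 2 := by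
    have h1 (m : σ) := Equiv.prod_comp Fin.revPerm fun j => frobeniusSq (columnOperator hN (A m) j)
    simp only [Fin.revPerm_apply] at h1
    simp only [h1, sum_prod_frobeniusSq_columnOperator hN A hc, norm_mul, mul_pow,
      ← Finset.mul_sum, hc1, norm_inv, inv_pow, norm_eprScale_sq, mul_one]
  obtain ⟨m, hm⟩ : ∃ m, c m ≠ 0 := by
    by_contra! h
    simp [h] at hc1
  obtain ⟨V, hV, hUV⟩ := exists_unitary_factors
    (fun j => columnOperator hN (A m) (Fin.rev j)) hU ((c m)⁻¹ * eprScale k (n + 1))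
    (by rw [hprod, smul_smul, mul_assoc, mul_inv_cancel_left₀ hα, inv_mul_cancel₀ hm, one_smul])
    fun j => ⟨_, conjTranspose_mul_self_of_sum_prod_frobeniusSq _ hU _ hprod hsum m
      (mul_ne_zero (inv_ne_zero hα) hm) j⟩
  refine ⟨V, fun j => ⟨(hV j).1, ?_⟩, hUV⟩
  obtain ⟨s, hs⟩ := (hV j).2
  rw [hs]
  exact hasChainForm_smul_columnOperator hk hN (A m) _ s
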